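/- Let $X\subset\mathbb{R}^n$ be compact and convex, let $y_1,\dots,y_N\in\mathbb{R}^n$ be distinct points, $Y=\{y_1,\dots,y_N\}$, and let $c:X\times Y\to\mathbb{R}$ be continuous. Let $\rho$ be a probability measure on $X$ that is absolutely continuous with respect to Lebesgue measure, with a density bounded on $X$ from above and from below by positive constants, and let $\mu=\sum_{k=1}^N\mu_k\delta_{y_k}$ be a probability measure with $\mu_k>0$ for all $k$. For $\psi\in\mathbb{R}^N$ and $t\in[0,1)$ set $$\Phi(\psi,t)=\int_X(1-t)\log\Big[\sum_{k=1}^N e^{\frac{\psi_k-tc(x,y_k)}{1-t}}\Big]\,d\rho(x)-\sum_{k=1}^N\psi_k\mu_k-(1-t).$$ Write $\nabla\Phi$ and $\nabla^2\Phi$ for the gradient and the Hessian in $\psi$, and $\mathbf 1=(1,\dots,1)$. At closed end points, derivatives in $t$ are one-sided. Then $\Phi$ is smooth on $\mathbb{R}^N\times[0,1)$, and there is a curve $\psi:[0,1)\to\mathbb{R}^N$ such that, for every $t\in[0,1)$, $\psi(t)$ minimizes $\Phi(\cdot,t)$ over $\mathbb{R}^N$ and $\psi(t)\perp\mathbf 1$.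 Every such curve $\psi$ is smooth ($C^\infty$) on $[0,1)$, and it is the unique differentiable curve with values in $\mathbf 1^\perp$ that solves the Cauchy problem $$\nabla^2\Phi(\psi(t),t)\,\psi'(t)+\frac{\partial}{\partial t}\nabla\Phi(\psi(t),t)=0\quad (t\in[0,1)),\qquad \psi(0)=\log\mu-\frac1N\sum_{k=1}^N\log\mu_k,$$ where $(\log\mu)_i=\log\mu_i$ and the mean is subtracted from every coordinate. Moreover, for every $\bar t\in(0,1)$, any differentiable curve $[0,\bar t]\to\mathbf 1^\perp$ that solves this problem on $[0,\bar t]$ coincides with $\psi$ on $[0,\bar t]$. -/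

import Mathlib

open MeasureTheory Set
open scoped ContDiff

namespace SemiDiscreteOT

noncomputable section

/-- `ρ` is carried by `X` and has there a density with respect to Lebesgue measure which is
bounded from above and bounded from below by a positive constant. -/
def HasBoundedDensityOn {n : ℕ} (ρ : Measure (EuclideanSpace ℝ (Fin n)))
    (X : Set (EuclideanSpace ℝ (Fin n))) : Prop :=
  ∃ r : EuclideanSpace ℝ (Fin n) → ℝ, Measurable r ∧
    (∃ m M : ℝ, 0 < m ∧ ∀ x ∈ X, m ≤ r x ∧ r x ≤ M) ∧
    ρ = (volume.restrict X).withDensity (fun x => ENNReal.ofReal (r x))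

/-- The entropic dual functional
`Φ(ψ,t) = ∫_X (1-t) log (∑ k, exp ((ψ k - t c(x, y k)) / (1-t))) dρ(x) - ∑ k, ψ k μ k - (1-t)`. -/
def Phi {n N : ℕ} (X : Set (EuclideanSpace ℝ (Fin n))) (y : Fin N → EuclideanSpace ℝ (Fin n))
    (c : EuclideanSpace ℝ (Fin n) → EuclideanSpace ℝ (Fin n) → ℝ)
    (ρ : Measure (EuclideanSpace ℝ (Fin n))) (μ : Fin N → ℝ)
    (ψ : EuclideanSpace ℝ (Fin N)) (t : ℝ) : ℝ :=
  (∫ x in X, (1 - t) * Real.log (∑ k, Real.exp ((ψ k - t * c x (y k)) / (1 - t))) ∂ρ)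
    - ∑ k, ψ k * μ k - (1 - t)

/-- The gradient `∇F(ψ,t)` in the variable `ψ`. -/
def grad {N : ℕ} (F : EuclideanSpace ℝ (Fin N) → ℝ → ℝ) (ψ : EuclideanSpace ℝ (Fin N)) (t : ℝ) :
    EuclideanSpace ℝ (Fin N) :=
  gradient (fun φ => F φ t) ψ

/-- The Hessian `∇²F(ψ,t)` in the variable `ψ`, as a linear operator on `ℝ^N`. -/
def hess {N : ℕ} (F : EuclideanSpace ℝ (Fin N) → ℝ → ℝ) (ψ : EuclideanSpace ℝ (Fin N)) (t : ℝ) :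
    EuclideanSpace ℝ (Fin N) →L[ℝ] EuclideanSpace ℝ (Fin N) :=
  fderiv ℝ (fun φ => grad F φ t) ψ

/-- The mixed derivative `∂_t ∇F(ψ,t)`, for `t ∈ [0,1)` (one-sided at `t = 0`). -/
def dtGrad {N : ℕ} (F : EuclideanSpace ℝ (Fin N) → ℝ → ℝ) (ψ : EuclideanSpace ℝ (Fin N))
    (t : ℝ) : EuclideanSpace ℝ (Fin N) :=
  derivWithin (fun s => grad F ψ s) (Ico 0 1) t

/-- For every `t ∈ [0,1)` the vector `ψ t` minimizes `F(·,t)` over `ℝ^N`, and it is normalized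
by `ψ t ⟂ (1,…,1)`. -/
def IsMinimizerCurve {N : ℕ} (F : EuclideanSpace ℝ (Fin N) → ℝ → ℝ)
    (ψ : ℝ → EuclideanSpace ℝ (Fin N)) : Prop :=
  ∀ t ∈ Ico (0 : ℝ) 1, (∀ φ, F (ψ t) t ≤ F φ t) ∧ ∑ k, ψ t k = 0

/-- The initial value `log μ - (1/N) ∑ k, log μ k`. -/
def initialValue {N : ℕ} (μ : Fin N → ℝ) : EuclideanSpace ℝ (Fin N) :=
  WithLp.toLp 2 (fun i => Real.log (μ i) - (1 / (N : ℝ)) * ∑ k, Real.log (μ k))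

/-- `ψ` is a differentiable solution on the interval `J` (containing `0`) of the Cauchy problem
`∇²F(ψ,t) ψ' + ∂_t ∇F(ψ,t) = 0`, `ψ(0) = ψ₀`, with values in the hyperplane `(1,…,1)^⟂`.
At an end point of `J` that belongs to `J`, `ψ'` is the one-sided derivative. -/
def IsCauchySolution {N : ℕ} (F : EuclideanSpace ℝ (Fin N) → ℝ → ℝ)
    (ψ₀ : EuclideanSpace ℝ (Fin N)) (J : Set ℝ) (ψ : ℝ → EuclideanSpace ℝ (Fin N)) : Prop :=
  ψ 0 = ψ₀ ∧
  ∀ t ∈ J, ∑ k, ψ t k = 0 ∧ DifferentiableWithinAt ℝ ψ J t ∧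
    hess F (ψ t) t (derivWithin ψ J t) + dtGrad F (ψ t) t = 0

end

end SemiDiscreteOT

open SemiDiscreteOT

/-! The integrand depends on `x` only through the cost vector, which stays in a compact set, and it
is smooth for all `t < 1`. Hence differentiation under the integral makes `Φ` smooth on the open set
`t < 1`, and one-sided derivatives at `t = 0` are restrictions of ordinary ones.

The gradient in `ψ` is the averaged Gibbs weight minus `μ`. Its derivative in direction `w`, paired
with `w`, is `(1 - t)⁻¹` times the averaged Gibbs variance of `w`, positive unless `w` is constant
(`hasDerivAt_dualGrad_line`). So at most one critical point lies in `𝟏^⊥`; coercivity there gives a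
minimizer (`exists_minimizer`).

The inverse function theorem makes the curve of critical points smooth
(`contDiffOn_critical_curve`). The differential equation says that the gradient is constant along
the curve (`hess_add_dtGrad_dual`), and the initial value is critical at `t = 0`. A solution
therefore consists of critical points, and uniqueness of these replaces any uniqueness theorem for
differential equations. -/

namespace SemiDiscreteOT

open MeasureTheory Set Filter Topology
open scoped ContDiff

set_option linter.unusedSectionVars false

/-! ### Smoothness of parameter-dependent integrals -/

section ParametricIntegral

universe u

variable {α : Type*} [MeasurableSpace α] {ν : Measure α} [IsFiniteMeasure ν]
  {V : Type*} [NormedAddCommGroup V] [NormedSpace ℝ V]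
  {E F : Type u} [NormedAddCommGroup E] [NormedSpace ℝ E] [FiniteDimensional ℝ E]
  [NormedAddCommGroup F] [NormedSpace ℝ F] {f : α → V} {K : Set V} {U : Set E}

lemma aestronglyMeasurable_section {G : E × V → F}
    (hG : ContinuousOn G (U ×ˢ univ)) (hf : AEStronglyMeasurable f ν) {p : E} (hp : p ∈ U) :
    AEStronglyMeasurable (fun x => G (p, f x)) ν := by
  have h : Continuous (fun v => G (p, v)) := by
    rw [← continuousOn_univ]
    exact hG.comp (by fun_prop) (fun v _ => ⟨hp, mem_univ _⟩)
  exact h.comp_aestronglyMeasurable hf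

/-- A compact neighbourhood times `K` is compact. The constant `C` serves as dominating function,
since `ν` is finite. -/
lemma exists_nhds_bound {G : E × V → F} (hU : IsOpen U) (hG : ContinuousOn G (U ×ˢ univ))
    (hK : IsCompact K) {p : E} (hp : p ∈ U) :
    ∃ s ∈ 𝓝 p, s ⊆ U ∧ ∃ C : ℝ, ∀ q ∈ s, ∀ v ∈ K, ‖G (q, v)‖ ≤ C := by
  have : ProperSpace E := FiniteDimensional.proper ℝ E
  obtain ⟨s, hs, hsU, hsc⟩ := LocallyCompactSpace.local_compact_nhds p U (hU.mem_nhds hp)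
  obtain ⟨C, hC⟩ := (hsc.prod hK).exists_bound_of_continuousOn
    (hG.mono (prod_mono hsU (subset_univ _)))
  exact ⟨s, hs, hsU, C, fun q hq v hv => hC (q, v) ⟨hq, hv⟩⟩

lemma integrable_section {G : E × V → F} (hU : IsOpen U) (hG : ContinuousOn G (U ×ˢ univ))
    (hK : IsCompact K) (hf : AEStronglyMeasurable f ν) (hfK : ∀ᵐ x ∂ν, f x ∈ K)
    {p : E} (hp : p ∈ U) : Integrable (fun x => G (p, f x)) ν := by
  obtain ⟨s, hs, -, C, hC⟩ := exists_nhds_bound hU hG hK hp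
  exact Integrable.of_bound (aestronglyMeasurable_section hG hf hp) C
    (hfK.mono fun x hx => hC p (mem_of_mem_nhds hs) _ hx)

lemma continuousOn_integral_section {G : E × V → F} (hU : IsOpen U)
    (hG : ContinuousOn G (U ×ˢ univ))
    (hK : IsCompact K) (hf : AEStronglyMeasurable f ν) (hfK : ∀ᵐ x ∂ν, f x ∈ K) :
    ContinuousOn (fun p => ∫ x, G (p, f x) ∂ν) U := by
  intro p hp
  obtain ⟨s, hs, hsU, C, hC⟩ := exists_nhds_bound hU hG hK hp
  refine (continuousAt_of_dominated (bound := fun _ => C) ?_ ?_ (integrable_const C)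
    ?_).continuousWithinAt
  · filter_upwards [hs] with q hq
    exact aestronglyMeasurable_section hG hf (hsU hq)
  · filter_upwards [hs] with q hq
    exact hfK.mono fun x hx => hC q hq _ hx
  · refine Eventually.of_forall fun x => ?_
    have : ContinuousAt G (p, f x) := hG.continuousAt ((hU.prod isOpen_univ).mem_nhds ⟨hp, trivial⟩)
    exact this.comp (f := fun q => (q, f x)) (by fun_prop)

/-- Differentiation under the integral sign, for an integrand which depends on the integration
variable through a function with values in a compact set. -/
lemma hasFDerivAt_integral_section {G : E × V → F} {G' : E × V → E →L[ℝ] F} (hU : IsOpen U)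
    (hG : ContinuousOn G (U ×ˢ univ)) (hG' : ContinuousOn G' (U ×ˢ univ))
    (hd : ∀ p ∈ U, ∀ v, HasFDerivAt (fun q => G (q, v)) (G' (p, v)) p)
    (hK : IsCompact K) (hf : AEStronglyMeasurable f ν) (hfK : ∀ᵐ x ∂ν, f x ∈ K)
    {p : E} (hp : p ∈ U) :
    HasFDerivAt (fun p => ∫ x, G (p, f x) ∂ν) (∫ x, G' (p, f x) ∂ν) p := by
  obtain ⟨s, hs, hsU, C, hC⟩ := exists_nhds_bound hU hG' hK hp
  refine hasFDerivAt_integral_of_dominated_of_fderiv_le (bound := fun _ => C)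
    (F' := fun q x => G' (q, f x)) hs ?_
    (integrable_section hU hG hK hf hfK hp)
    (aestronglyMeasurable_section hG' hf hp)
    (hfK.mono fun x hx q hq => hC q hq _ hx) (integrable_const C)
    (Eventually.of_forall fun x q hq => hd q (hsU hq) _)
  filter_upwards [hs] with q hq
  exact aestronglyMeasurable_section hG hf (hsU hq)

lemma hasFDerivAt_section {G : E × V → F} (hU : IsOpen U) (hG : ContDiffOn ℝ ∞ G (U ×ˢ univ))
    {p : E} (hp : p ∈ U) (v : V) :
    HasFDerivAt (fun q => G (q, v))
      ((fderiv ℝ G (p, v)).comp (ContinuousLinearMap.inl ℝ E V)) p := by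
  have h : HasFDerivAt G (fderiv ℝ G (p, v)) (p, v) :=
    ((hG.contDiffAt ((hU.prod isOpen_univ).mem_nhds ⟨hp, trivial⟩)).differentiableAt
      (by simp)).hasFDerivAt
  exact h.comp p (hasFDerivAt_prodMk_left p v)

/-- The induction must range over all target spaces, because the derivative takes values in `E →L[ℝ]
F`; sharing one universe between `E` and `F` keeps that space in range. -/
lemma contDiffOn_natCast_integral_section (hU : IsOpen U)
    (hK : IsCompact K) (hf : AEStronglyMeasurable f ν) (hfK : ∀ᵐ x ∂ν, f x ∈ K) (m : ℕ) :
    ∀ {F : Type u} [NormedAddCommGroup F] [NormedSpace ℝ F] {G : E × V → F},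
      ContDiffOn ℝ ∞ G (U ×ˢ univ) → ContDiffOn ℝ m (fun p => ∫ x, G (p, f x) ∂ν) U := by
  induction m with
  | zero =>
    intro F _ _ G hG
    exact contDiffOn_zero.2 (continuousOn_integral_section hU hG.continuousOn hK hf hfK)
  | succ m ih =>
    intro F _ _ G hG
    have hG' : ContDiffOn ℝ ∞
        (fun z => (fderiv ℝ G z).comp (ContinuousLinearMap.inl ℝ E V)) (U ×ˢ univ) :=
      (hG.fderiv_of_isOpen (hU.prod isOpen_univ) (by simp)).clm_comp contDiffOn_const
    have hd : ∀ p ∈ U, HasFDerivAt (fun p => ∫ x, G (p, f x) ∂ν) _ p := fun p hp =>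
      hasFDerivAt_integral_section hU hG.continuousOn hG'.continuousOn
        (fun p hp v => hasFDerivAt_section hU hG hp v) hK hf hfK hp
    push_cast
    rw [contDiffOn_succ_iff_fderiv_of_isOpen hU]
    refine ⟨fun p hp => (hd p hp).differentiableAt.differentiableWithinAt, by simp, ?_⟩
    exact (ih hG').congr fun p hp => (hd p hp).fderiv

/-- An integral depending smoothly on a parameter in an open subset of a finite-dimensional space
is a smooth function of the parameter. -/
theorem contDiffOn_integral_section (hU : IsOpen U) {G : E × V → F}
    (hG : ContDiffOn ℝ ∞ G (U ×ˢ univ))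
    (hK : IsCompact K) (hf : AEStronglyMeasurable f ν) (hfK : ∀ᵐ x ∂ν, f x ∈ K) :
    ContDiffOn ℝ ∞ (fun p => ∫ x, G (p, f x) ∂ν) U :=
  contDiffOn_infty.2 fun m => contDiffOn_natCast_integral_section hU hK hf hfK m hG

end ParametricIntegral


/-! ### Gibbs weights and pointwise derivatives -/

section DualFunctional

variable {ι : Type} [Fintype ι]

/-- The sum `∑ k, exp ((ψ k - t v k) / (1 - t))` at `z = ((ψ, t), v)`. -/
noncomputable def partitionSum (z : (EuclideanSpace ℝ ι × ℝ) × (ι → ℝ)) : ℝ :=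
  ∑ k, Real.exp ((z.1.1 k - z.1.2 * z.2 k) / (1 - z.1.2))

/-- The normalized weights `exp ((ψ k - t v k) / (1 - t)) / ∑ j, exp ((ψ j - t v j) / (1 - t))`. -/
noncomputable def gibbs (k : ι) (z : (EuclideanSpace ℝ ι × ℝ) × (ι → ℝ)) : ℝ :=
  Real.exp ((z.1.1 k - z.1.2 * z.2 k) / (1 - z.1.2)) / partitionSum z

/-- The regularized maximum `(1 - t) log ∑ k, exp ((ψ k - t v k) / (1 - t))`. -/
noncomputable def softMax (z : (EuclideanSpace ℝ ι × ℝ) × (ι → ℝ)) : ℝ :=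
  (1 - z.1.2) * Real.log (partitionSum z)

/-- The entropic dual functional for the cost vector `f` on a measure space. -/
noncomputable def dual {α : Type*} [MeasurableSpace α] (ν : Measure α) (f : α → ι → ℝ) (μ : ι → ℝ)
    (ψ : EuclideanSpace ℝ ι) (t : ℝ) : ℝ :=
  (∫ x, softMax ((ψ, t), f x) ∂ν) - ∑ k, ψ k * μ k - (1 - t)

/-- The gradient of `dual` in the variable `ψ`. -/
noncomputable def dualGrad {α : Type*} [MeasurableSpace α] (ν : Measure α) (f : α → ι → ℝ)
    (μ : ι → ℝ) (ψ : EuclideanSpace ℝ ι) (t : ℝ) : EuclideanSpace ℝ ι :=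
  WithLp.toLp 2 fun k => (∫ x, gibbs k ((ψ, t), f x) ∂ν) - μ k

lemma contDiffOn_exponent (k : ι) :
    ContDiffOn ℝ ∞ (fun z : (EuclideanSpace ℝ ι × ℝ) × (ι → ℝ) =>
      Real.exp ((z.1.1 k - z.1.2 * z.2 k) / (1 - z.1.2)))
      (((univ : Set (EuclideanSpace ℝ ι)) ×ˢ Iio (1 : ℝ)) ×ˢ univ) := by
  have h1 : ContDiff ℝ ∞ (fun z : (EuclideanSpace ℝ ι × ℝ) × (ι → ℝ) => z.1.1 k) := by fun_prop
  have h2 : ContDiff ℝ ∞ (fun z : (EuclideanSpace ℝ ι × ℝ) × (ι → ℝ) => z.2 k) := by fun_prop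
  refine ContDiffOn.exp (ContDiffOn.div (h1.sub (contDiff_fst.snd.mul h2)).contDiffOn
    (contDiff_const.sub contDiff_fst.snd).contDiffOn ?_)
  rintro z ⟨⟨-, hz⟩, -⟩
  exact (sub_pos.2 hz).ne'

lemma contDiffOn_partitionSum :
    ContDiffOn ℝ ∞ (partitionSum (ι := ι)) ((univ ×ˢ Iio (1 : ℝ)) ×ˢ univ) :=
  ContDiffOn.sum fun k _ => contDiffOn_exponent k

variable [Nonempty ι]

lemma partitionSum_pos (z : (EuclideanSpace ℝ ι × ℝ) × (ι → ℝ)) : 0 < partitionSum z :=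
  Finset.sum_pos (fun _ _ => Real.exp_pos _) Finset.univ_nonempty

lemma contDiffOn_softMax :
    ContDiffOn ℝ ∞ (softMax (ι := ι)) ((univ ×ˢ Iio (1 : ℝ)) ×ˢ univ) :=
  (contDiff_const.sub contDiff_fst.snd).contDiffOn.mul
    (contDiffOn_partitionSum.log fun z _ => (partitionSum_pos z).ne')

lemma contDiffOn_gibbs (k : ι) :
    ContDiffOn ℝ ∞ (gibbs k) ((univ ×ˢ Iio (1 : ℝ)) ×ˢ univ) :=
  (contDiffOn_exponent k).div contDiffOn_partitionSum fun z _ => (partitionSum_pos z).ne'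

lemma gibbs_pos (k : ι) (z : (EuclideanSpace ℝ ι × ℝ) × (ι → ℝ)) : 0 < gibbs k z :=
  div_pos (Real.exp_pos _) (partitionSum_pos z)

lemma sum_gibbs (z : (EuclideanSpace ℝ ι × ℝ) × (ι → ℝ)) : ∑ k, gibbs k z = 1 := by
  unfold gibbs
  rw [← Finset.sum_div]
  exact div_self (partitionSum_pos z).ne'

lemma hasDerivAt_exponent_line (ψ w : EuclideanSpace ℝ ι) (t s : ℝ) (v : ι → ℝ) (k : ι) :
    HasDerivAt (fun s : ℝ => Real.exp (((ψ + s • w) k - t * v k) / (1 - t)))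
      (Real.exp (((ψ + s • w) k - t * v k) / (1 - t)) * (w k / (1 - t))) s := by
  refine HasDerivAt.exp (HasDerivAt.div_const (HasDerivAt.sub_const _ ?_) _)
  simpa using ((hasDerivAt_id s).mul_const (w k)).const_add (ψ k)

lemma hasDerivAt_partitionSum_line (ψ w : EuclideanSpace ℝ ι) (t s : ℝ) (v : ι → ℝ) :
    HasDerivAt (fun s : ℝ => partitionSum ((ψ + s • w, t), v))
      (∑ k, Real.exp (((ψ + s • w) k - t * v k) / (1 - t)) * (w k / (1 - t))) s :=
  HasDerivAt.fun_sum fun k _ => hasDerivAt_exponent_line ψ w t s v k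

lemma hasDerivAt_softMax_line (ψ w : EuclideanSpace ℝ ι) {t : ℝ} (ht : t < 1) (s : ℝ)
    (v : ι → ℝ) :
    HasDerivAt (fun s : ℝ => softMax ((ψ + s • w, t), v))
      (∑ k, w k * gibbs k ((ψ + s • w, t), v)) s := by
  have h := ((hasDerivAt_partitionSum_line ψ w t s v).log
    (partitionSum_pos _).ne').const_mul (1 - t)
  refine h.congr_deriv ?_
  have h1 : 1 - t ≠ 0 := (sub_pos.2 ht).ne'
  rw [Finset.sum_div, Finset.mul_sum]
  refine Finset.sum_congr rfl fun k _ => ?_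
  simp only [gibbs]
  field_simp

/-- Tilting the weights in direction `w` changes the mean of `w` at the rate of its variance, scaled
by the inverse temperature `(1 - t)⁻¹`. -/
lemma hasDerivAt_sum_gibbs_line (ψ w : EuclideanSpace ℝ ι) {t : ℝ} (ht : t < 1) (s : ℝ)
    (v : ι → ℝ) :
    HasDerivAt (fun s : ℝ => ∑ k, w k * gibbs k ((ψ + s • w, t), v))
      ((1 - t)⁻¹ * ∑ k, gibbs k ((ψ + s • w, t), v) *
        (w k - ∑ j, w j * gibbs j ((ψ + s • w, t), v)) ^ 2) s := by
  have h1 : 1 - t ≠ 0 := (sub_pos.2 ht).ne'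
  have hZ := (partitionSum_pos ((ψ + s • w, t), v)).ne'
  have h := HasDerivAt.fun_sum (u := Finset.univ) fun k _ =>
    ((hasDerivAt_exponent_line ψ w t s v k).fun_div (hasDerivAt_partitionSum_line ψ w t s v)
      hZ).const_mul (w k)
  refine h.congr_deriv ?_
  set z := ((ψ + s • w, t), v) with hz
  set m := ∑ j, w j * gibbs j z with hm
  have hsum := sum_gibbs z
  have hD : ∑ k, Real.exp (((ψ + s • w) k - t * v k) / (1 - t)) * (w k / (1 - t))
      = (1 - t)⁻¹ * m * partitionSum z := by
    rw [hm, Finset.mul_sum, Finset.sum_mul]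
    refine Finset.sum_congr rfl fun k _ => ?_
    have hZ' : partitionSum ((ψ + s • w, t), v) ≠ 0 := hZ
    simp only [gibbs, hz]
    field_simp
  rw [hD]
  have hl : ∀ k, w k * ((Real.exp (((ψ + s • w) k - t * v k) / (1 - t)) * (w k / (1 - t))
      * partitionSum z - Real.exp (((ψ + s • w) k - t * v k) / (1 - t))
        * ((1 - t)⁻¹ * m * partitionSum z)) / partitionSum z ^ 2)
      = (1 - t)⁻¹ * (gibbs k z * w k ^ 2 - m * (w k * gibbs k z)) := by
    intro k
    simp only [gibbs, hz]
    field_simp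
  -- Expanded so that, after summation with total weight 1, the last two terms become `-m²` and
  -- `+m²` and cancel.
  have hr : ∀ k, gibbs k z * (w k - m) ^ 2
      = (gibbs k z * w k ^ 2 - m * (w k * gibbs k z)) - m * (w k * gibbs k z)
        + m ^ 2 * gibbs k z := by
    intro k; ring
  rw [Finset.sum_congr rfl fun k _ => hl k, Finset.sum_congr rfl fun k _ => hr k,
    ← Finset.mul_sum, Finset.sum_add_distrib,
    Finset.sum_sub_distrib (f := fun k => gibbs k z * w k ^ 2 - m * (w k * gibbs k z)),
    ← Finset.mul_sum,
    ← Finset.mul_sum, hsum, ← hm]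
  ring

/-- All weights are positive, and a nonconstant `w` differs from its mean somewhere. -/
lemma variance_gibbs_pos {w : EuclideanSpace ℝ ι} (hw : ∃ i j, w i ≠ w j)
    (z : (EuclideanSpace ℝ ι × ℝ) × (ι → ℝ)) :
    0 < ∑ k, gibbs k z * (w k - ∑ j, w j * gibbs j z) ^ 2 := by
  obtain ⟨i, j, hij⟩ := hw
  set m := ∑ j, w j * gibbs j z
  have hk : ∃ k, w k ≠ m := by
    by_contra! h
    exact hij ((h i).trans (h j).symm)
  obtain ⟨k, hk⟩ := hk
  refine Finset.sum_pos' (fun k _ => mul_nonneg (gibbs_pos k z).le (sq_nonneg _))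
    ⟨k, Finset.mem_univ k, mul_pos (gibbs_pos k z) ?_⟩
  have := sub_ne_zero.2 hk
  positivity

end DualFunctional

/-! ### Derivatives of the integrated functional -/

section Calculus

variable {ι : Type} [Fintype ι] [Nonempty ι] {α : Type*} [MeasurableSpace α] {ν : Measure α}
  [IsProbabilityMeasure ν] {f : α → ι → ℝ} {K : Set (ι → ℝ)} {μ : ι → ℝ}

/-- Differentiation under the integral sign along a line `s ↦ ψ + s w` in the variable `ψ`. -/
lemma hasDerivAt_integral_line {g h : (EuclideanSpace ℝ ι × ℝ) × (ι → ℝ) → ℝ}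
    (hg : ContDiffOn ℝ ∞ g ((univ ×ˢ Iio (1 : ℝ)) ×ˢ univ))
    (hh : ContDiffOn ℝ ∞ h ((univ ×ˢ Iio (1 : ℝ)) ×ˢ univ))
    (ψ w : EuclideanSpace ℝ ι) {t : ℝ} (ht : t < 1)
    (hd : ∀ s v, HasDerivAt (fun s : ℝ => g ((ψ + s • w, t), v)) (h ((ψ + s • w, t), v)) s)
    (hK : IsCompact K) (hf : AEStronglyMeasurable f ν) (hfK : ∀ᵐ x ∂ν, f x ∈ K) (s : ℝ) :
    HasDerivAt (fun s : ℝ => ∫ x, g ((ψ + s • w, t), f x) ∂ν)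
      (∫ x, h ((ψ + s • w, t), f x) ∂ν) s := by
  have hline : ∀ {g : (EuclideanSpace ℝ ι × ℝ) × (ι → ℝ) → ℝ},
      ContDiffOn ℝ ∞ g ((univ ×ˢ Iio (1 : ℝ)) ×ˢ univ) →
      ContinuousOn (fun z : ℝ × (ι → ℝ) => g ((ψ + z.1 • w, t), z.2)) (univ ×ˢ univ) := by
    intro g hg
    exact hg.continuousOn.comp (by fun_prop) fun z _ => ⟨⟨trivial, ht⟩, trivial⟩
  have key := hasFDerivAt_integral_section (ν := ν) (f := f) isOpen_univ (hline hg)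
    (G' := fun z => ContinuousLinearMap.toSpanSingleton ℝ (h ((ψ + z.1 • w, t), z.2)))
    ((ContinuousLinearMap.toSpanSingletonCLE (𝕜 := ℝ) (E := ℝ)).continuous.comp_continuousOn
      (hline hh))
    (fun s _ v => (hd s v).hasFDerivAt) hK hf hfK (mem_univ s)
  refine key.hasDerivAt.congr_deriv ?_
  have hi := integrable_section isOpen_univ (hline hh) hK hf hfK (mem_univ s)
  -- The derivative is an integral of linear maps; pulling the integral inside and evaluating at 1
  -- gives the scalar derivative.
  have := ContinuousLinearMap.integral_comp_comm
    (ContinuousLinearMap.toSpanSingletonCLE (𝕜 := ℝ) (E := ℝ)).toContinuousLinearMap hi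
  have h2 := congrArg (fun L : ℝ →L[ℝ] ℝ => L 1) this
  exact h2.trans (by simp)

lemma integrable_gibbs (hK : IsCompact K) (hf : AEStronglyMeasurable f ν)
    (hfK : ∀ᵐ x ∂ν, f x ∈ K) (ψ : EuclideanSpace ℝ ι) {t : ℝ} (ht : t < 1) (k : ι) :
    Integrable (fun x => gibbs k ((ψ, t), f x)) ν :=
  integrable_section (isOpen_univ.prod isOpen_Iio) (contDiffOn_gibbs k).continuousOn hK hf hfK
    ⟨trivial, ht⟩

lemma sum_mul_dualGrad (hK : IsCompact K) (hf : AEStronglyMeasurable f ν)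
    (hfK : ∀ᵐ x ∂ν, f x ∈ K) (ψ w : EuclideanSpace ℝ ι) {t : ℝ} (ht : t < 1) :
    ∑ k, w k * dualGrad ν f μ ψ t k
      = (∫ x, ∑ k, w k * gibbs k ((ψ, t), f x) ∂ν) - ∑ k, w k * μ k := by
  rw [integral_finsetSum _ fun k _ => (integrable_gibbs hK hf hfK ψ ht k).const_mul (w k)]
  simp only [dualGrad, mul_sub, Finset.sum_sub_distrib, integral_const_mul]

lemma sum_dualGrad (hK : IsCompact K) (hf : AEStronglyMeasurable f ν)
    (hfK : ∀ᵐ x ∂ν, f x ∈ K) (hμ : ∑ k, μ k = 1) (ψ : EuclideanSpace ℝ ι) {t : ℝ} (ht : t < 1) :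
    ∑ k, dualGrad ν f μ ψ t k = 0 := by
  have h := sum_mul_dualGrad (μ := μ) hK hf hfK ψ (WithLp.toLp 2 fun _ => 1) ht
  simpa [sum_gibbs, hμ] using h

lemma hasDerivAt_dual_line (hK : IsCompact K) (hf : AEStronglyMeasurable f ν)
    (hfK : ∀ᵐ x ∂ν, f x ∈ K) (ψ w : EuclideanSpace ℝ ι) {t : ℝ} (ht : t < 1) (s : ℝ) :
    HasDerivAt (fun s : ℝ => dual ν f μ (ψ + s • w) t)
      (∑ k, w k * dualGrad ν f μ (ψ + s • w) t k) s := by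
  rw [sum_mul_dualGrad hK hf hfK _ w ht]
  have h1 := hasDerivAt_integral_line contDiffOn_softMax
    (h := fun z => ∑ k, w k * gibbs k z)
    (ContDiffOn.sum fun k _ => contDiffOn_const.mul (contDiffOn_gibbs k)) ψ w ht
    (hasDerivAt_softMax_line ψ w ht) hK hf hfK s
  refine (h1.sub (HasDerivAt.fun_sum fun k _ => ?_)).sub_const (1 - t)
  have := ((hasDerivAt_id s).mul_const (w k)).const_add (ψ k)
  simpa using this.mul_const (μ k)

/-- The derivative is the integral of an everywhere positive variance against a probability measure.
Only its sign is needed later. -/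
lemma hasDerivAt_dualGrad_line (hK : IsCompact K) (hf : AEStronglyMeasurable f ν)
    (hfK : ∀ᵐ x ∂ν, f x ∈ K) (ψ : EuclideanSpace ℝ ι) {w : EuclideanSpace ℝ ι}
    (hw : ∃ i j, w i ≠ w j) {t : ℝ} (ht : t < 1) (s : ℝ) :
    ∃ d > 0, HasDerivAt (fun s : ℝ => ∑ k, w k * dualGrad ν f μ (ψ + s • w) t k) d s := by
  have hm : ContDiffOn ℝ ∞ (fun z => ∑ k, w k * gibbs k z) ((univ ×ˢ Iio (1 : ℝ)) ×ˢ univ) :=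
    ContDiffOn.sum fun k _ => contDiffOn_const.mul (contDiffOn_gibbs k)
  have hvar : ContDiffOn ℝ ∞
      (fun z => (1 - t)⁻¹ * ∑ k, gibbs k z * (w k - ∑ j, w j * gibbs j z) ^ 2)
      ((univ ×ˢ Iio (1 : ℝ)) ×ˢ univ) :=
    contDiffOn_const.mul (ContDiffOn.sum fun k _ =>
      (contDiffOn_gibbs k).mul ((contDiffOn_const.sub hm).pow 2))
  have h1 := hasDerivAt_integral_line hm hvar ψ w ht (hasDerivAt_sum_gibbs_line ψ w ht) hK hf hfK s
  have hpos : ∀ z : (EuclideanSpace ℝ ι × ℝ) × (ι → ℝ),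
      0 < (1 - t)⁻¹ * ∑ k, gibbs k z * (w k - ∑ j, w j * gibbs j z) ^ 2 := fun z =>
    mul_pos (inv_pos.2 (sub_pos.2 ht)) (variance_gibbs_pos hw z)
  refine ⟨_, ?_, h1.sub_const (∑ k, w k * μ k) |>.congr_of_eventuallyEq ?_⟩
  rotate_left
  · exact Eventually.of_forall fun s => sum_mul_dualGrad hK hf hfK _ w ht
  · have hi := integrable_section (ν := ν) (f := f) (isOpen_univ.prod isOpen_Iio)
      hvar.continuousOn hK hf hfK (p := (ψ + s • w, t)) ⟨trivial, ht⟩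
    refine (integral_pos_iff_support_of_nonneg (fun x => (hpos _).le) hi).2 ?_
    have : Function.support (fun x => (1 - t)⁻¹ * ∑ k, gibbs k ((ψ + s • w, t), f x) *
        (w k - ∑ j, w j * gibbs j ((ψ + s • w, t), f x)) ^ 2) = univ :=
      eq_univ_of_forall fun x => (hpos _).ne'
    rw [this]
    simp

lemma contDiffOn_dual (hK : IsCompact K) (hf : AEStronglyMeasurable f ν)
    (hfK : ∀ᵐ x ∂ν, f x ∈ K) :
    ContDiffOn ℝ ∞ (fun p : EuclideanSpace ℝ ι × ℝ => dual ν f μ p.1 p.2)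
      (univ ×ˢ Iio (1 : ℝ)) := by
  have h1 := contDiffOn_integral_section (ν := ν) (f := f) (isOpen_univ.prod isOpen_Iio)
    contDiffOn_softMax hK hf hfK
  have h2 : ContDiff ℝ ∞ (fun p : EuclideanSpace ℝ ι × ℝ => ∑ k, p.1 k * μ k) := by fun_prop
  have h3 : ContDiff ℝ ∞ (fun p : EuclideanSpace ℝ ι × ℝ => 1 - p.2) := by fun_prop
  exact (h1.sub h2.contDiffOn).sub h3.contDiffOn

lemma contDiffOn_dualGrad (hK : IsCompact K) (hf : AEStronglyMeasurable f ν)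
    (hfK : ∀ᵐ x ∂ν, f x ∈ K) :
    ContDiffOn ℝ ∞ (fun p : EuclideanSpace ℝ ι × ℝ => dualGrad ν f μ p.1 p.2)
      (univ ×ˢ Iio (1 : ℝ)) := by
  rw [contDiffOn_euclidean]
  intro k
  exact (contDiffOn_integral_section (ν := ν) (f := f) (isOpen_univ.prod isOpen_Iio)
    (contDiffOn_gibbs k) hK hf hfK).sub contDiffOn_const

/-- Joint smoothness gives differentiability, so derivatives along lines determine the gradient. -/
lemma hasGradientAt_dual (hK : IsCompact K) (hf : AEStronglyMeasurable f ν)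
    (hfK : ∀ᵐ x ∂ν, f x ∈ K) (ψ : EuclideanSpace ℝ ι) {t : ℝ} (ht : t < 1) :
    HasGradientAt (fun φ => dual ν f μ φ t) (dualGrad ν f μ ψ t) ψ := by
  have hd : DifferentiableAt ℝ (fun φ => dual ν f μ φ t) ψ := by
    have := ((contDiffOn_dual (μ := μ) hK hf hfK).contDiffAt
      ((isOpen_univ.prod isOpen_Iio).mem_nhds (x := (ψ, t)) ⟨trivial, ht⟩)).differentiableAt
      (by simp)
    exact this.comp ψ (f := fun φ => (φ, t)) (by fun_prop)
  rw [hasGradientAt_iff_hasFDerivAt]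
  suffices h : InnerProductSpace.toDual ℝ _ (dualGrad ν f μ ψ t)
      = fderiv ℝ (fun φ => dual ν f μ φ t) ψ by
    rw [h]
    exact hd.hasFDerivAt
  ext w
  have h0 : ψ + (0 : ℝ) • w = ψ := by simp
  have h1 := hasDerivAt_dual_line (μ := μ) hK hf hfK ψ w ht 0
  have h2 : HasDerivAt (fun s : ℝ => dual ν f μ (ψ + s • w) t)
      (fderiv ℝ (fun φ => dual ν f μ φ t) ψ w) 0 := by
    refine HasFDerivAt.comp_hasDerivAt (f := fun s : ℝ => ψ + s • w) 0
      (by rw [h0]; exact hd.hasFDerivAt) ?_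
    simpa using ((hasDerivAt_id (0 : ℝ)).smul_const w).const_add ψ
  rw [h2.unique h1, h0]
  simp [PiLp.inner_apply]

end Calculus

/-! ### Uniqueness and existence of normalized minimizers -/

section Critical

variable {ι : Type} [Fintype ι] [Nonempty ι] {α : Type*} [MeasurableSpace α] {ν : Measure α}
  [IsProbabilityMeasure ν] {f : α → ι → ℝ} {K : Set (ι → ℝ)} {μ : ι → ℝ}

lemma sum_mul_dualGrad_of_const (hK : IsCompact K) (hf : AEStronglyMeasurable f ν)
    (hfK : ∀ᵐ x ∂ν, f x ∈ K) (hμ : ∑ k, μ k = 1) (ψ : EuclideanSpace ℝ ι)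
    {w : EuclideanSpace ℝ ι} (hw : ∀ i j, w i = w j) {t : ℝ} (ht : t < 1) :
    ∑ k, w k * dualGrad ν f μ ψ t k = 0 := by
  obtain ⟨i⟩ := ‹Nonempty ι›
  rw [Finset.sum_congr rfl fun k _ => by rw [hw k i], ← Finset.mul_sum,
    sum_dualGrad hK hf hfK hμ ψ ht, mul_zero]

lemma eq_zero_of_const {w : EuclideanSpace ℝ ι} (hw : ∀ i j, w i = w j) (hs : ∑ k, w k = 0) :
    w = 0 := by
  ext i
  rw [Finset.sum_congr rfl fun k _ => hw k i] at hs
  simpa using hs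

lemma strictMono_dualGrad_line (hK : IsCompact K) (hf : AEStronglyMeasurable f ν)
    (hfK : ∀ᵐ x ∂ν, f x ∈ K) (ψ : EuclideanSpace ℝ ι) {w : EuclideanSpace ℝ ι}
    (hw : ∃ i j, w i ≠ w j) {t : ℝ} (ht : t < 1) :
    StrictMono (fun s : ℝ => ∑ k, w k * dualGrad ν f μ (ψ + s • w) t k) := by
  refine strictMono_of_deriv_pos fun s => ?_
  obtain ⟨d, hd, h⟩ := hasDerivAt_dualGrad_line (μ := μ) hK hf hfK ψ hw ht s
  rwa [h.deriv]

/-- There is at most one critical point with vanishing coordinate sum. -/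
lemma eq_of_dualGrad_eq_zero (hK : IsCompact K) (hf : AEStronglyMeasurable f ν)
    (hfK : ∀ᵐ x ∂ν, f x ∈ K) {ψ φ : EuclideanSpace ℝ ι} {t : ℝ} (ht : t < 1)
    (hψ : dualGrad ν f μ ψ t = 0) (hφ : dualGrad ν f μ φ t = 0)
    (hψs : ∑ k, ψ k = 0) (hφs : ∑ k, φ k = 0) : φ = ψ := by
  by_contra hne
  have hc : ∃ i j, (φ - ψ) i ≠ (φ - ψ) j := by
    by_contra! hc
    refine hne (sub_eq_zero.1 (eq_zero_of_const hc ?_))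
    simp [Finset.sum_sub_distrib, hψs, hφs]
  have := strictMono_dualGrad_line (μ := μ) hK hf hfK ψ hc ht zero_lt_one
  simp [hψ, hφ] at this

lemma dual_add_const (hK : IsCompact K) (hf : AEStronglyMeasurable f ν)
    (hfK : ∀ᵐ x ∂ν, f x ∈ K) (hμ : ∑ k, μ k = 1) (ψ : EuclideanSpace ℝ ι)
    {w : EuclideanSpace ℝ ι} (hw : ∀ i j, w i = w j) {t : ℝ} (ht : t < 1) :
    dual ν f μ (ψ + w) t = dual ν f μ ψ t := by
  have hg := fun s => hasDerivAt_dual_line (μ := μ) hK hf hfK ψ w ht s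
  simp only [sum_mul_dualGrad_of_const hK hf hfK hμ _ hw ht] at hg
  have := is_const_of_deriv_eq_zero (fun s => (hg s).differentiableAt) (fun s => (hg s).deriv) 1 0
  simpa using this

lemma dualGrad_eq_zero_of_forall_le (hK : IsCompact K) (hf : AEStronglyMeasurable f ν)
    (hfK : ∀ᵐ x ∂ν, f x ∈ K) {ψ : EuclideanSpace ℝ ι} {t : ℝ} (ht : t < 1)
    (hmin : ∀ φ, dual ν f μ ψ t ≤ dual ν f μ φ t) : dualGrad ν f μ ψ t = 0 := by
  have hloc : IsLocalMin (fun φ => dual ν f μ φ t) ψ := Eventually.of_forall hmin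
  have := hloc.hasFDerivAt_eq_zero
    (hasGradientAt_iff_hasFDerivAt.1 (hasGradientAt_dual (μ := μ) hK hf hfK ψ ht))
  simpa using this

lemma le_softMax (ψ : EuclideanSpace ℝ ι) {t : ℝ} (ht : t < 1) (v : ι → ℝ) (k : ι) :
    ψ k - t * v k ≤ softMax ((ψ, t), v) := by
  have h1 : 0 < 1 - t := sub_pos.2 ht
  have h2 : (ψ k - t * v k) / (1 - t) ≤ Real.log (partitionSum ((ψ, t), v)) := by
    rw [Real.le_log_iff_exp_le (partitionSum_pos _)]
    exact Finset.single_le_sum (f := fun k => Real.exp ((ψ k - t * v k) / (1 - t)))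
      (fun _ _ => (Real.exp_pos _).le) (Finset.mem_univ k)
  have := (div_le_iff₀' h1).1 h2
  exact this

/-- The soft maximum dominates each `ψ k - t v k`, and the costs are bounded. The constant depends
on neither `ψ` nor `k`. -/
lemma exists_le_dual (hK : IsCompact K) (hf : AEStronglyMeasurable f ν)
    (hfK : ∀ᵐ x ∂ν, f x ∈ K) {t : ℝ} (ht : t < 1) :
    ∃ C : ℝ, ∀ (ψ : EuclideanSpace ℝ ι) (k : ι), ψ k - ∑ j, ψ j * μ j - C ≤ dual ν f μ ψ t := by
  obtain ⟨R, hR⟩ := hK.isBounded.exists_norm_le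
  refine ⟨|t| * R + (1 - t), fun ψ k => ?_⟩
  have hi := integrable_section (ν := ν) (f := f) (isOpen_univ.prod isOpen_Iio)
    contDiffOn_softMax.continuousOn hK hf hfK (p := (ψ, t)) ⟨trivial, ht⟩
  have h : ψ k - |t| * R ≤ ∫ x, softMax ((ψ, t), f x) ∂ν := by
    have h1 : ∫ _, (ψ k - |t| * R) ∂ν ≤ ∫ x, softMax ((ψ, t), f x) ∂ν := by
      refine integral_mono_ae (integrable_const _) hi ?_
      filter_upwards [hfK] with x hx
      refine le_trans ?_ (le_softMax ψ ht (f x) k)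
      have h2 : t * f x k ≤ |t| * R := by
        refine (le_abs_self _).trans ?_
        rw [abs_mul]
        exact mul_le_mul_of_nonneg_left ((norm_le_pi_norm (f x) k).trans (hR _ hx)) (abs_nonneg t)
      linarith
    simpa using h1
  unfold dual
  linarith

/-- On the hyperplane `∑ k, ψ k = 0` the sublevel sets of the dual functional are bounded. -/
lemma exists_abs_le_of_dual_le (hK : IsCompact K) (hf : AEStronglyMeasurable f ν)
    (hfK : ∀ᵐ x ∂ν, f x ∈ K) (hμpos : ∀ k, 0 < μ k) (hμ : ∑ k, μ k = 1) {t : ℝ} (ht : t < 1)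
    (D : ℝ) : ∃ R : ℝ, ∀ ψ : EuclideanSpace ℝ ι, ∑ k, ψ k = 0 → dual ν f μ ψ t ≤ D →
      ∀ k, |ψ k| ≤ R := by
  obtain ⟨C, hC⟩ := exists_le_dual (μ := μ) hK hf hfK ht
  obtain ⟨i₀, hi₀⟩ := Finite.exists_min μ
  refine ⟨(D + C) / μ i₀, fun ψ hs hD => ?_⟩
  obtain ⟨M, hM⟩ := Finite.exists_max ψ
  -- The `μ`-average of the nonnegative gaps is at most `D + C`, so dividing by the smallest weight
  -- bounds each gap.
  have hgap : ∀ j, ψ M - ψ j ≤ (D + C) / μ i₀ := by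
    intro j
    rw [le_div_iff₀ (hμpos i₀)]
    calc (ψ M - ψ j) * μ i₀ ≤ (ψ M - ψ j) * μ j :=
          mul_le_mul_of_nonneg_left (hi₀ j) (sub_nonneg.2 (hM j))
      _ ≤ ∑ k, (ψ M - ψ k) * μ k :=
          Finset.single_le_sum (f := fun k => (ψ M - ψ k) * μ k)
            (fun k _ => mul_nonneg (sub_nonneg.2 (hM k)) (hμpos k).le) (Finset.mem_univ j)
      _ = ψ M - ∑ k, ψ k * μ k := by
          simp only [sub_mul, Finset.sum_sub_distrib, ← Finset.mul_sum, hμ, mul_one]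
      _ ≤ D + C := by linarith [hC ψ M]
  -- With zero sum, some coordinate is nonpositive and some nonnegative; bounded gaps then bound
  -- every coordinate.
  have hle : ∃ j, ψ j ≤ 0 := by
    by_contra! h
    exact (Finset.sum_pos (fun k _ => h k) Finset.univ_nonempty).ne' hs
  have hge : ∃ j, 0 ≤ ψ j := by
    by_contra! h
    exact (Finset.sum_neg (fun k _ => h k) Finset.univ_nonempty).ne hs
  obtain ⟨j, hj⟩ := hle
  obtain ⟨l, hl⟩ := hge
  intro k
  have h1 := hgap k
  have h2 := hgap j
  have h3 := hM k
  have h4 := hM l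
  exact abs_le.2 ⟨by linarith, by linarith⟩

lemma exists_minimizer (hK : IsCompact K) (hf : AEStronglyMeasurable f ν)
    (hfK : ∀ᵐ x ∂ν, f x ∈ K) (hμpos : ∀ k, 0 < μ k) (hμ : ∑ k, μ k = 1) {t : ℝ} (ht : t < 1) :
    ∃ ψ : EuclideanSpace ℝ ι, (∀ φ, dual ν f μ ψ t ≤ dual ν f μ φ t) ∧ ∑ k, ψ k = 0 := by
  have hcont : Continuous (fun φ => dual ν f μ φ t) := by
    rw [← continuousOn_univ]
    exact (contDiffOn_dual hK hf hfK).continuousOn.comp (f := fun φ => (φ, t)) (by fun_prop)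
      fun φ _ => ⟨trivial, ht⟩
  have hclosed : IsClosed {ψ : EuclideanSpace ℝ ι | ∑ k, ψ k = 0} :=
    isClosed_eq (by fun_prop) continuous_const
  obtain ⟨R, hR⟩ := exists_abs_le_of_dual_le hK hf hfK hμpos hμ ht (dual ν f μ 0 t)
  have hcomp : IsCompact (EuclideanSpace.equiv ι ℝ ⁻¹' Icc (fun _ => -R) (fun _ => R)) :=
    (EuclideanSpace.equiv ι ℝ).toHomeomorph.isClosedEmbedding.isCompact_preimage isCompact_Icc
  obtain ⟨ψ, hψ, hmin⟩ := hcont.continuousOn.exists_isMinOn' hclosed (x₀ := 0) (by simp) (by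
    rw [eventually_inf_principal]
    filter_upwards [hcomp.compl_mem_cocompact] with φ hφ hs
    by_contra! hlt
    refine hφ ⟨fun k => (abs_le.1 (hR φ hs hlt.le k)).1, fun k => (abs_le.1 (hR φ hs hlt.le k)).2⟩)
  refine ⟨ψ, fun φ => ?_, hψ⟩
  -- The constant shift that moves `φ` into the hyperplane without changing the functional.
  let w : EuclideanSpace ℝ ι := WithLp.toLp 2 fun _ => -(∑ k, φ k) / Fintype.card ι
  rw [← dual_add_const hK hf hfK hμ φ (w := w) (fun _ _ => rfl) ht]
  refine hmin ?_
  have : (Fintype.card ι : ℝ) ≠ 0 := by simp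
  simp only [mem_ofPred_eq, w, PiLp.add_apply, Finset.sum_add_distrib, Finset.sum_const,
    Finset.card_univ, nsmul_eq_mul]
  field_simp
  ring

end Critical

/-! ### Smooth dependence of critical points on `t` -/

section Curve

variable {ι : Type} [Fintype ι] [Nonempty ι] {α : Type*} [MeasurableSpace α] {ν : Measure α}
  [IsProbabilityMeasure ν] {f : α → ι → ℝ} {K : Set (ι → ℝ)} {μ : ι → ℝ}

lemma contDiffAt_dualGrad (hK : IsCompact K) (hf : AEStronglyMeasurable f ν)
    (hfK : ∀ᵐ x ∂ν, f x ∈ K) (ψ : EuclideanSpace ℝ ι) {t : ℝ} (ht : t < 1) :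
    ContDiffAt ℝ ∞ (fun p : EuclideanSpace ℝ ι × ℝ => dualGrad ν f μ p.1 p.2) (ψ, t) :=
  (contDiffOn_dualGrad hK hf hfK).contDiffAt
    ((isOpen_univ.prod isOpen_Iio).mem_nhds ⟨trivial, ht⟩)

lemma hasFDerivAt_dualGrad (hK : IsCompact K) (hf : AEStronglyMeasurable f ν)
    (hfK : ∀ᵐ x ∂ν, f x ∈ K) (ψ : EuclideanSpace ℝ ι) {t : ℝ} (ht : t < 1) :
    HasFDerivAt (fun p : EuclideanSpace ℝ ι × ℝ => dualGrad ν f μ p.1 p.2)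
      (fderiv ℝ (fun p : EuclideanSpace ℝ ι × ℝ => dualGrad ν f μ p.1 p.2) (ψ, t)) (ψ, t) :=
  ((contDiffAt_dualGrad hK hf hfK ψ ht).differentiableAt (by simp)).hasFDerivAt

lemma hasDerivAt_sum_mul_dualGrad_line (hK : IsCompact K) (hf : AEStronglyMeasurable f ν)
    (hfK : ∀ᵐ x ∂ν, f x ∈ K) (ψ w : EuclideanSpace ℝ ι) {t : ℝ} (ht : t < 1) :
    HasDerivAt (fun s : ℝ => ∑ k, w k * dualGrad ν f μ (ψ + s • w) t k)
      (∑ k, w k * fderiv ℝ (fun p : EuclideanSpace ℝ ι × ℝ => dualGrad ν f μ p.1 p.2) (ψ, t)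
        (w, 0) k) 0 := by
  have hline : HasDerivAt (fun s : ℝ => (ψ + s • w, t)) (w, 0) 0 := by
    refine HasDerivAt.prodMk ?_ (hasDerivAt_const _ _)
    simpa using ((hasDerivAt_id (0 : ℝ)).smul_const w).const_add ψ
  have h := HasFDerivAt.comp_hasDerivAt (f := fun s : ℝ => (ψ + s • w, t)) (0 : ℝ)
    (by simpa using hasFDerivAt_dualGrad (μ := μ) hK hf hfK ψ ht) hline
  exact HasDerivAt.fun_sum fun k _ =>
    ((EuclideanSpace.proj k : EuclideanSpace ℝ ι →L[ℝ] ℝ).hasFDerivAt.comp_hasDerivAt (0 : ℝ)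
      h).const_mul (w k)

/-- Pairing with `w` gives `⟨w, D w⟩ = -(∑ w)²`. For nonconstant `w` the left side is positive, a
contradiction; for constant `w` it is zero, so `∑ w = 0` and `w = 0`. -/
lemma eq_zero_of_fderiv_dualGrad_add (hK : IsCompact K) (hf : AEStronglyMeasurable f ν)
    (hfK : ∀ᵐ x ∂ν, f x ∈ K) (hμ : ∑ k, μ k = 1) (ψ w : EuclideanSpace ℝ ι) {t : ℝ} (ht : t < 1)
    (hw : ∀ k, fderiv ℝ (fun p : EuclideanSpace ℝ ι × ℝ => dualGrad ν f μ p.1 p.2) (ψ, t)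
      (w, 0) k + ∑ j, w j = 0) : w = 0 := by
  have h := hasDerivAt_sum_mul_dualGrad_line (μ := μ) hK hf hfK ψ w ht
  have hsum : ∑ k, w k * fderiv ℝ (fun p : EuclideanSpace ℝ ι × ℝ => dualGrad ν f μ p.1 p.2)
      (ψ, t) (w, 0) k = -(∑ j, w j) ^ 2 := by
    rw [Finset.sum_congr rfl fun k _ => by rw [eq_neg_of_add_eq_zero_left (hw k)],
      ← Finset.sum_mul]
    ring
  rw [hsum] at h
  by_cases hc : ∃ i j, w i ≠ w j
  · obtain ⟨d, hd, h'⟩ := hasDerivAt_dualGrad_line (μ := μ) hK hf hfK ψ hc ht 0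
    have := h.unique h'
    nlinarith [sq_nonneg (∑ j, w j)]
  · push Not at hc
    simp only [sum_mul_dualGrad_of_const hK hf hfK hμ _ hc ht] at h
    have := h.unique (hasDerivAt_const (0 : ℝ) (0 : ℝ))
    exact eq_zero_of_const hc (by simpa using this)

/-- A curve of normalized critical points is smooth, by the inverse function theorem. -/
lemma contDiffOn_critical_curve (hK : IsCompact K) (hf : AEStronglyMeasurable f ν)
    (hfK : ∀ᵐ x ∂ν, f x ∈ K) (hμ : ∑ k, μ k = 1) {J : Set ℝ} (hJ : J ⊆ Iio 1)
    {ψ : ℝ → EuclideanSpace ℝ ι} (hψ : ∀ t ∈ J, dualGrad ν f μ (ψ t) t = 0)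
    (hψs : ∀ t ∈ J, ∑ k, ψ t k = 0) : ContDiffOn ℝ ∞ ψ J := by
  intro t ht
  have ht1 : t < 1 := hJ ht
  -- The Hessian kills constants; adding the coordinate sum to every entry removes this kernel.
  -- Carrying `t` along turns the inverse function theorem into an implicit one.
  let H : EuclideanSpace ℝ ι × ℝ → EuclideanSpace ℝ ι × ℝ := fun p =>
    (dualGrad ν f μ p.1 p.2 + WithLp.toLp 2 (fun _ => ∑ k, p.1 k), p.2)
  let S : EuclideanSpace ℝ ι × ℝ →L[ℝ] EuclideanSpace ℝ ι :=
    LinearMap.toContinuousLinearMap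
      { toFun := fun p => WithLp.toLp 2 (fun _ => ∑ k, p.1 k)
        map_add' := fun p q => by ext i; simp [Finset.sum_add_distrib]
        map_smul' := fun a p => by ext i; simp [Finset.mul_sum] }
  have hHc : ContDiffAt ℝ ∞ H (ψ t, t) :=
    ((contDiffAt_dualGrad hK hf hfK _ ht1).add S.contDiff.contDiffAt).prodMk contDiffAt_snd
  set D := fderiv ℝ (fun p : EuclideanSpace ℝ ι × ℝ => dualGrad ν f μ p.1 p.2) (ψ t, t) with hD
  have hHd : HasFDerivAt H ((D + S).prod (ContinuousLinearMap.snd ℝ _ _)) (ψ t, t) :=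
    ((hasFDerivAt_dualGrad hK hf hfK _ ht1).add S.hasFDerivAt).prodMk hasFDerivAt_snd
  have hinj : Function.Injective ((D + S).prod (ContinuousLinearMap.snd ℝ _ _)) := by
    rw [injective_iff_map_eq_zero]
    rintro ⟨w, τ⟩ h
    obtain ⟨h1, h2⟩ := Prod.ext_iff.1 h
    have hτ : τ = 0 := h2
    subst hτ
    have hw := eq_zero_of_fderiv_dualGrad_add hK hf hfK hμ (ψ t) w ht1 fun k =>
      congrArg (fun u : EuclideanSpace ℝ ι => u k) h1
    rw [hw]
    rfl
  let e : (EuclideanSpace ℝ ι × ℝ) ≃L[ℝ] (EuclideanSpace ℝ ι × ℝ) :=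
    (LinearEquiv.ofInjectiveEndo
      ((D + S).prod (ContinuousLinearMap.snd ℝ _ _)).toLinearMap hinj).toContinuousLinearEquiv
  have hHe : HasFDerivAt H (e : EuclideanSpace ℝ ι × ℝ →L[ℝ] EuclideanSpace ℝ ι × ℝ) (ψ t, t) :=
    hHd
  have hn : (∞ : WithTop ℕ∞) ≠ 0 := by simp
  have hHt : H (ψ t, t) = (0, t) := by
    refine Prod.ext ?_ rfl
    ext k
    simp [H, hψ t ht, hψs t ht]
  have hL := hHc.to_localInverse hHe hn
  have hinv := (hHc.hasStrictFDerivAt' hHe hn).eventually_right_inverse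
  change ∀ᶠ z in 𝓝 (H (ψ t, t)), H (hHc.localInverse hHe hn z) = z at hinv
  set L := hHc.localInverse hHe hn
  rw [hHt] at hL hinv
  have hcurve : ContDiffAt ℝ ∞ (fun s : ℝ => ((0 : EuclideanSpace ℝ ι), s)) t :=
    contDiffAt_const.prodMk contDiffAt_id
  have hsm : ContDiffAt ℝ ∞ (fun s : ℝ => (L (0, s)).1) t :=
    contDiffAt_fst.comp t (hL.comp t hcurve)
  have hev : ∀ᶠ s in 𝓝 t, H (L (0, s)) = (0, s) := hcurve.continuousAt.eventually hinv
  -- Global uniqueness of normalized critical points identifies `ψ s` with the local branch, so no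
  -- continuity of `ψ` is needed.
  have heq : ∀ s ∈ J, H (L (0, s)) = (0, s) → ψ s = (L (0, s)).1 := by
    intro s hs h
    obtain ⟨h1, h2⟩ := Prod.ext_iff.1 h
    have h3 : (L (0, s)).2 = s := h2
    have h4 : ∀ k, dualGrad ν f μ (L (0, s)).1 s k + ∑ j, (L (0, s)).1 j = 0 := fun k => by
      have := congrArg (fun u : EuclideanSpace ℝ ι => u k) h1
      simpa [H, h3] using this
    -- The gradient has zero coordinate sum, so summing over `k` leaves only a multiple of the added
    -- term.
    have h5 : ∑ j, (L (0, s)).1 j = 0 := by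
      have h6 := Finset.sum_congr (rfl : (Finset.univ : Finset ι) = _) fun k _ => h4 k
      rw [Finset.sum_add_distrib, sum_dualGrad hK hf hfK hμ _ (hJ hs)] at h6
      simpa using h6
    have h7 : dualGrad ν f μ (L (0, s)).1 s = 0 := by
      ext k
      simpa [h5] using h4 k
    exact eq_of_dualGrad_eq_zero hK hf hfK (hJ hs) h7 (hψ s hs) h5 (hψs s hs)
  refine hsm.contDiffWithinAt.congr_of_eventuallyEq ?_ (heq t ht hev.self_of_nhds)
  filter_upwards [self_mem_nhdsWithin, mem_nhdsWithin_of_mem_nhds hev] with s hs h using heq s hs h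

lemma hasDerivWithinAt_dualGrad_comp (hK : IsCompact K) (hf : AEStronglyMeasurable f ν)
    (hfK : ∀ᵐ x ∂ν, f x ∈ K) {φ : ℝ → EuclideanSpace ℝ ι} {φ' : EuclideanSpace ℝ ι} {J : Set ℝ}
    {t : ℝ} (ht : t < 1) (hφ : HasDerivWithinAt φ φ' J t) :
    HasDerivWithinAt (fun s => dualGrad ν f μ (φ s) s)
      (fderiv ℝ (fun p : EuclideanSpace ℝ ι × ℝ => dualGrad ν f μ p.1 p.2) (φ t, t) (φ', 1))
      J t :=
  HasFDerivAt.comp_hasDerivWithinAt (f := fun s => (φ s, s)) t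
    (hasFDerivAt_dualGrad hK hf hfK (φ t) ht) (hφ.prodMk (hasDerivWithinAt_id t J))

end Curve

/-! ### The Cauchy problem -/

section Cauchy

variable {N : ℕ} [Nonempty (Fin N)] {α : Type*} [MeasurableSpace α] {ν : Measure α}
  [IsProbabilityMeasure ν] {f : α → Fin N → ℝ} {K : Set (Fin N → ℝ)} {μ : Fin N → ℝ}

lemma grad_dual (hK : IsCompact K) (hf : AEStronglyMeasurable f ν)
    (hfK : ∀ᵐ x ∂ν, f x ∈ K) (ψ : EuclideanSpace ℝ (Fin N)) {t : ℝ} (ht : t < 1) :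
    grad (dual ν f μ) ψ t = dualGrad ν f μ ψ t :=
  (hasGradientAt_dual hK hf hfK ψ ht).gradient

/-- By the chain rule, the left side of the equation is the total derivative of the gradient along a
curve with velocity `v`. -/
lemma hess_add_dtGrad_dual (hK : IsCompact K) (hf : AEStronglyMeasurable f ν)
    (hfK : ∀ᵐ x ∂ν, f x ∈ K) (ψ v : EuclideanSpace ℝ (Fin N)) {t : ℝ} (ht : t ∈ Ico (0 : ℝ) 1) :
    hess (dual ν f μ) ψ t v + dtGrad (dual ν f μ) ψ t
      = fderiv ℝ (fun p : EuclideanSpace ℝ (Fin N) × ℝ => dualGrad ν f μ p.1 p.2) (ψ, t)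
        (v, 1) := by
  have hG := hasFDerivAt_dualGrad (μ := μ) hK hf hfK ψ ht.2
  have h1 : (fun φ => grad (dual ν f μ) φ t) = fun φ => dualGrad ν f μ φ t :=
    funext fun φ => grad_dual hK hf hfK φ ht.2
  have h2 : HasFDerivAt (fun φ => dualGrad ν f μ φ t) _ ψ :=
    HasFDerivAt.comp (f := fun φ => (φ, t)) ψ hG (hasFDerivAt_prodMk_left ψ t)
  have h3 : dtGrad (dual ν f μ) ψ t
      = fderiv ℝ (fun p : EuclideanSpace ℝ (Fin N) × ℝ => dualGrad ν f μ p.1 p.2) (ψ, t)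
        (0, 1) := by
    have h4 := hasDerivWithinAt_dualGrad_comp (μ := μ) hK hf hfK ht.2
      (hasDerivWithinAt_const t (Ico 0 1) ψ)
    have h5 := h4.congr (f₁ := fun s => grad (dual ν f μ) ψ s)
      (fun s hs => grad_dual hK hf hfK ψ hs.2) (grad_dual hK hf hfK ψ ht.2)
    exact h5.derivWithin (uniqueDiffOn_Ico 0 1 t ht)
  rw [h3, hess, h1, h2.fderiv, ContinuousLinearMap.comp_apply, ← map_add]
  simp

/-- At `t = 0` the cost drops out and the Gibbs weights of `log μ` are `μ` itself; the subtracted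
mean cancels in the quotient. -/
lemma dualGrad_initialValue (hμpos : ∀ k, 0 < μ k) (hμ : ∑ k, μ k = 1) :
    dualGrad ν f μ (initialValue μ) 0 = 0 := by
  have hg : ∀ k v, gibbs k ((initialValue μ, (0 : ℝ)), v) = μ k := by
    intro k v
    have he : ∀ j, Real.exp (initialValue μ j)
        = μ j / Real.exp ((1 / (N : ℝ)) * ∑ k, Real.log (μ k)) := fun j => by
      simp only [initialValue, Real.exp_sub, Real.exp_log (hμpos j)]
    have hne := (Real.exp_pos ((1 / (N : ℝ)) * ∑ k, Real.log (μ k))).ne'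
    simp only [gibbs, partitionSum, zero_mul, sub_zero, div_one, he, ← Finset.sum_div, hμ]
    field_simp
  ext k
  simp [dualGrad, hg]

lemma sum_initialValue : ∑ k, initialValue μ k = 0 := by
  have hN : (N : ℝ) ≠ 0 := by
    have := Fintype.card_ne_zero (α := Fin N)
    simpa using this
  simp only [initialValue, Finset.sum_sub_distrib, Finset.sum_const, Finset.card_univ,
    Fintype.card_fin, nsmul_eq_mul]
  field_simp
  ring

lemma IsMinimizerCurve.dualGrad_eq_zero (hK : IsCompact K) (hf : AEStronglyMeasurable f ν)
    (hfK : ∀ᵐ x ∂ν, f x ∈ K) {ψ : ℝ → EuclideanSpace ℝ (Fin N)}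
    (hψ : IsMinimizerCurve (dual ν f μ) ψ) : ∀ t ∈ Ico (0 : ℝ) 1, dualGrad ν f μ (ψ t) t = 0 :=
  fun t ht => dualGrad_eq_zero_of_forall_le hK hf hfK ht.2 (hψ t ht).1

lemma IsMinimizerCurve.contDiffOn (hK : IsCompact K) (hf : AEStronglyMeasurable f ν)
    (hfK : ∀ᵐ x ∂ν, f x ∈ K) (hμ : ∑ k, μ k = 1) {ψ : ℝ → EuclideanSpace ℝ (Fin N)}
    (hψ : IsMinimizerCurve (dual ν f μ) ψ) : ContDiffOn ℝ ∞ ψ (Ico 0 1) :=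
  contDiffOn_critical_curve hK hf hfK hμ (fun _ ht => ht.2)
    (hψ.dualGrad_eq_zero hK hf hfK) fun t ht => (hψ t ht).2

lemma IsMinimizerCurve.isCauchySolution (hK : IsCompact K) (hf : AEStronglyMeasurable f ν)
    (hfK : ∀ᵐ x ∂ν, f x ∈ K) (hμpos : ∀ k, 0 < μ k) (hμ : ∑ k, μ k = 1)
    {ψ : ℝ → EuclideanSpace ℝ (Fin N)} (hψ : IsMinimizerCurve (dual ν f μ) ψ) :
    IsCauchySolution (dual ν f μ) (initialValue μ) (Ico 0 1) ψ := by
  have hcrit := hψ.dualGrad_eq_zero hK hf hfK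
  refine ⟨?_, fun t ht => ?_⟩
  · have h0 : (0 : ℝ) ∈ Ico (0 : ℝ) 1 := by simp
    exact eq_of_dualGrad_eq_zero hK hf hfK zero_lt_one (dualGrad_initialValue hμpos hμ)
      (hcrit 0 h0) sum_initialValue (hψ 0 h0).2
  · have hd : DifferentiableWithinAt ℝ ψ (Ico 0 1) t :=
      (hψ.contDiffOn hK hf hfK hμ).differentiableOn (by simp) t ht
    refine ⟨(hψ t ht).2, hd, ?_⟩
    rw [hess_add_dtGrad_dual hK hf hfK _ _ ht]
    have h1 := hasDerivWithinAt_dualGrad_comp (μ := μ) hK hf hfK ht.2 hd.hasDerivWithinAt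
    have h2 := (hasDerivWithinAt_const t (Ico (0 : ℝ) 1) (0 : EuclideanSpace ℝ (Fin N))).congr
      hcrit (hcrit t ht)
    exact (uniqueDiffOn_Ico (0 : ℝ) 1 t ht).eq_deriv _ h1 h2

/-- Along a solution of the Cauchy problem the gradient is constant, hence zero, so that the
solution consists of minimizers. -/
lemma IsCauchySolution.eqOn (hK : IsCompact K) (hf : AEStronglyMeasurable f ν)
    (hfK : ∀ᵐ x ∂ν, f x ∈ K) (hμpos : ∀ k, 0 < μ k) (hμ : ∑ k, μ k = 1) {J : Set ℝ}
    (hJ : J ⊆ Ico 0 1) (hJc : Convex ℝ J) (h0 : (0 : ℝ) ∈ J)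
    {φ ψ : ℝ → EuclideanSpace ℝ (Fin N)}
    (hφ : IsCauchySolution (dual ν f μ) (initialValue μ) J φ)
    (hψ : IsMinimizerCurve (dual ν f μ) ψ) : EqOn φ ψ J := by
  intro t ht
  have hd : ∀ s ∈ J, HasDerivWithinAt (fun s => dualGrad ν f μ (φ s) s) 0 J s := by
    intro s hs
    obtain ⟨-, h1, h2⟩ := hφ.2 s hs
    rw [hess_add_dtGrad_dual hK hf hfK _ _ (hJ hs)] at h2
    rw [← h2]
    exact hasDerivWithinAt_dualGrad_comp hK hf hfK (hJ hs).2 h1.hasDerivWithinAt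
  have hconst := hJc.norm_image_sub_le_of_norm_hasDerivWithin_le (C := 0) hd (by simp) h0 ht
  rw [zero_mul, norm_le_zero_iff, sub_eq_zero, hφ.1, dualGrad_initialValue hμpos hμ] at hconst
  exact eq_of_dualGrad_eq_zero hK hf hfK (hJ ht).2 (hψ.dualGrad_eq_zero hK hf hfK t (hJ ht)) hconst
    (hψ t (hJ ht)).2 (hφ.2 t ht).1

end Cauchy

/-! ### The cost vector and the restricted measure -/

section Cost

variable {n N : ℕ} {X : Set (EuclideanSpace ℝ (Fin n))} {y : Fin N → EuclideanSpace ℝ (Fin n)}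
  {c : EuclideanSpace ℝ (Fin n) → EuclideanSpace ℝ (Fin n) → ℝ}

lemma continuousOn_costVector (hc : ContinuousOn (Function.uncurry c) (X ×ˢ Set.range y)) :
    ContinuousOn (fun x k => c x (y k)) X :=
  continuousOn_pi.2 fun k => hc.comp (f := fun x => (x, y k)) (by fun_prop)
    fun _ hx => ⟨hx, mem_range_self k⟩

lemma HasBoundedDensityOn.restrict_eq {ρ : Measure (EuclideanSpace ℝ (Fin n))}
    (hX : MeasurableSet X) (hρ : HasBoundedDensityOn ρ X) : ρ.restrict X = ρ := by
  obtain ⟨r, -, -, rfl⟩ := hρ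
  rw [restrict_withDensity hX, Measure.restrict_restrict hX, inter_self]

end Cost

end SemiDiscreteOT

theorem mainTheorem2 {n N : ℕ}
    (X : Set (EuclideanSpace ℝ (Fin n))) (hX : IsCompact X) (hXconv : Convex ℝ X)
    (y : Fin N → EuclideanSpace ℝ (Fin n)) (hy : Function.Injective y)
    (c : EuclideanSpace ℝ (Fin n) → EuclideanSpace ℝ (Fin n) → ℝ)
    (hc : ContinuousOn (Function.uncurry c) (X ×ˢ Set.range y))
    (ρ : Measure (EuclideanSpace ℝ (Fin n))) [IsProbabilityMeasure ρ]
    (hρ : HasBoundedDensityOn ρ X)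
    (μ : Fin N → ℝ) (hμpos : ∀ k, 0 < μ k) (hμsum : ∑ k, μ k = 1) :
    -- `Φ` is smooth on `ℝ^N × [0,1)`, so that all derivatives below are genuine ones
    ContDiffOn ℝ ∞ (fun p : EuclideanSpace ℝ (Fin N) × ℝ => Phi X y c ρ μ p.1 p.2)
      (univ ×ˢ Ico 0 1) ∧
    -- the curve of normalized minimizers exists
    (∃ ψ : ℝ → EuclideanSpace ℝ (Fin N), IsMinimizerCurve (Phi X y c ρ μ) ψ) ∧
    -- it is smooth, and it is the unique solution of the Cauchy problem
    ∀ ψ : ℝ → EuclideanSpace ℝ (Fin N), IsMinimizerCurve (Phi X y c ρ μ) ψ →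
      ContDiffOn ℝ ∞ ψ (Ico 0 1) ∧
      IsCauchySolution (Phi X y c ρ μ) (initialValue μ) (Ico 0 1) ψ ∧
      (∀ φ : ℝ → EuclideanSpace ℝ (Fin N),
        IsCauchySolution (Phi X y c ρ μ) (initialValue μ) (Ico 0 1) φ → EqOn φ ψ (Ico 0 1)) ∧
      (∀ T ∈ Ioo (0 : ℝ) 1, ∀ φ : ℝ → EuclideanSpace ℝ (Fin N),
        IsCauchySolution (Phi X y c ρ μ) (initialValue μ) (Icc 0 T) φ → EqOn φ ψ (Icc 0 T)) := by
  have hN : Nonempty (Fin N) := by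
    by_contra h
    rw [not_nonempty_iff] at h
    simp at hμsum
  have hXm : MeasurableSet X := hX.measurableSet
  have hρX := hρ.restrict_eq hXm
  have : IsProbabilityMeasure (ρ.restrict X) := by rwa [hρX]
  have hcost := continuousOn_costVector hc
  have hK := hX.image_of_continuousOn hcost
  have hf : AEStronglyMeasurable (fun x k => c x (y k)) (ρ.restrict X) :=
    hcost.aestronglyMeasurable hXm
  have hfK : ∀ᵐ x ∂ρ.restrict X, (fun k => c x (y k)) ∈ (fun x k => c x (y k)) '' X :=
    (ae_restrict_mem hXm).mono fun x hx => mem_image_of_mem _ hx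
  -- The abstract results apply to `ρ.restrict X` and the cost vector; the two functionals agree by
  -- definition.
  have hPhi : Phi X y c ρ μ = dual (ρ.restrict X) (fun x k => c x (y k)) μ := rfl
  rw [hPhi]
  refine ⟨(contDiffOn_dual hK hf hfK).mono (prod_mono subset_rfl Ico_subset_Iio_self), ?_,
    fun ψ hψ => ⟨hψ.contDiffOn hK hf hfK hμsum, hψ.isCauchySolution hK hf hfK hμpos hμsum,
      fun φ hφ => hφ.eqOn hK hf hfK hμpos hμsum subset_rfl (convex_Ico 0 1) (by simp) hψ,
      fun T hT φ hφ => hφ.eqOn hK hf hfK hμpos hμsum (fun t ht => ⟨ht.1, ht.2.trans_lt hT.2⟩)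
        (convex_Icc 0 T) ⟨le_rfl, hT.1.le⟩ hψ⟩⟩
  choose! ψ hψ using fun t (ht : t ∈ Ico (0 : ℝ) 1) =>
    exists_minimizer hK hf hfK hμpos hμsum ht.2
  exact ⟨ψ, hψ⟩
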